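/- Let $K$ be an algebraically closed field of characteristic $p>0$. Then there exist a valuation $v$ on the rational function field $K(x,y)$ whose restriction to $K$ is trivial, an extension $w$ of $v$ to an algebraic closure of $K(x,y)$, and an infinite chain of intermediate fields $$K(x,y)=L_0\subseteq L_1\subseteq L_2\subseteq\cdots$$ of this algebraic closure such that, for every $i\ge 0$, the extension $(L_{i+1}|L_i,w)$ of valued fields is an immediate Galois extension of degree $p$ and defect $p$. Here an extension $(E|F,w)$ of valued fields is called immediate if the canonical embeddings of the value group of $F$ in the value group of $E$ and of the residue field of $F$ in the residue field of $E$ are surjective. The defect of a finite Galois extension $(E|F,w)$ is the number $$d=\frac{[E:F]}{e\,f\,g},$$ where $e=(wE:wF)$ is the ramification index, $f=[Ew:Fw]$ is the inertia degree, and $g$ is the number of distinct extensions of $w|_F$ from $F$ to $E$ (up to equivalence of valuations). -/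

import Mathlib

/-!
Extensions of valued fields. An extension `(E | F, w)` of valued fields is given by a field
extension `E | F` and a valuation `w` of the upper field `E`; the lower field `F` carries the
restriction `ValExt.restrict F w` of `w`.
-/

universe u

namespace ValExt

/-- The restriction to `F` of a valuation `w` on an extension field `E` of `F`. -/
abbrev restrict (F : Type*) {E Γ : Type*} [Field F] [Field E] [Algebra F E]
    [LinearOrderedCommGroupWithZero Γ] (w : Valuation E Γ) : Valuation F Γ :=
  w.comap (algebraMap F E)

instance hasExtension_restrict (F : Type*) {E Γ : Type*} [Field F] [Field E] [Algebra F E]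
    [LinearOrderedCommGroupWithZero Γ] (w : Valuation E Γ) :
    (restrict F w).HasExtension w :=
  ⟨Valuation.IsEquiv.refl⟩

/-- The value group `wE` of a valuation `w` on a field `E`: the group of the values of the nonzero
elements of `E` (written multiplicatively, inside the units of the target of `w`). -/
def valueGroup {E Γ : Type*} [Field E] [LinearOrderedCommGroupWithZero Γ] (w : Valuation E Γ) :
    Subgroup Γˣ :=
  (Units.map (w : E →* Γ)).range

/-- The residue field `Ew` of a valuation `w` on a field `E`. -/
abbrev Residue {E Γ : Type*} [Field E] [LinearOrderedCommGroupWithZero Γ] (w : Valuation E Γ) :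
    Type _ :=
  IsLocalRing.ResidueField w.valuationSubring

/-- The extension `(E | F, w)` is immediate: the canonical embeddings of the value group of `F` in
that of `E`, and of the residue field of `F` in that of `E`, are onto. -/
def IsImmediate (F : Type*) {E Γ : Type*} [Field F] [Field E] [Algebra F E]
    [LinearOrderedCommGroupWithZero Γ] (w : Valuation E Γ) : Prop :=
  valueGroup (restrict F w) = valueGroup w ∧
    Function.Surjective (algebraMap (Residue (restrict F w)) (Residue w))

/-- The ramification index `e = (wE : wF)`. -/
noncomputable def ramificationIndex (F : Type*) {E Γ : Type*} [Field F] [Field E] [Algebra F E]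
    [LinearOrderedCommGroupWithZero Γ] (w : Valuation E Γ) : ℕ :=
  (valueGroup (restrict F w)).relIndex (valueGroup w)

/-- The inertia degree `f = [Ew : Fw]`. -/
noncomputable def inertiaDegree (F : Type*) {E Γ : Type*} [Field F] [Field E] [Algebra F E]
    [LinearOrderedCommGroupWithZero Γ] (w : Valuation E Γ) : ℕ :=
  Module.finrank (Residue (restrict F w)) (Residue w)

/-- The number `g` of distinct extensions to `E` of the restriction of `w` to `F`. Valuations are
counted up to equivalence, that is, by their valuation rings. -/
noncomputable def numExtensions (F : Type*) {E Γ : Type*} [Field F] [Field E] [Algebra F E]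
    [LinearOrderedCommGroupWithZero Γ] (w : Valuation E Γ) : ℕ :=
  Set.ncard {B : ValuationSubring E |
    B.comap (algebraMap F E) = (restrict F w).valuationSubring}

/-- The defect `d` of a finite Galois extension `(E | F, w)` of valued fields, given by the
fundamental equality `[E : F] = d * e * f * g` (in a Galois extension all extensions of a valuation
of `F` are conjugate, so that `e`, `f` and `d` are the same for all of them). In particular
`[E : F] = d * e * f` if the extension of the valuation from `F` to `E` is unique. -/
noncomputable def defect (F : Type*) {E Γ : Type*} [Field F] [Field E] [Algebra F E]
    [FiniteDimensional F E] [IsGalois F E]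
    [LinearOrderedCommGroupWithZero Γ] (w : Valuation E Γ) : ℚ :=
  (Module.finrank F E : ℚ) /
    ((ramificationIndex F w : ℚ) * (inertiaDegree F w : ℚ) * (numExtensions F w : ℚ))

/-- The extension `(E | F, w)` of valued fields is an immediate Galois extension of degree `n` and
defect `d`. -/
def IsImmediateGaloisOfDegreeDefect (F : Type*) {E Γ : Type*} [Field F] [Field E] [Algebra F E]
    [LinearOrderedCommGroupWithZero Γ] (w : Valuation E Γ) (n d : ℕ) : Prop :=
  ∃ (_ : FiniteDimensional F E) (_ : IsGalois F E),
    Module.finrank F E = n ∧ IsImmediate F w ∧ defect F w = d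

end ValExt

/-- The rational function field `K(x, y)`. -/
abbrev RatFunc₂ (K : Type*) [Field K] : Type _ := FractionRing (MvPolynomial (Fin 2) K)

/-! Write valuations multiplicatively and put `℘ z = z ^ p - z`. Take `x 0 = x` with `w x > 1` and
`℘ (x (i + 1)) = x i`; then `w (x (i + 1))` is the `p`-th root of `w (x i)`. Let `y` be a
pseudo-limit of the series `∑ x (T i)`, `T i` the triangular numbers, with partial sums `S n`. The
chain is `L i = K(x i, y)`.

The gaps `T (n + 1) - T n = n + 1` are unbounded. With `u = y - S n` one has `w (x (T n)) = w u ^ p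
^ (n + 1)`, so the monomials in `x (T n)` and `u` of degree less than `p ^ (n + 1)` in `u` have
distinct values. For large `n` every nonzero polynomial in `x j` and `y` is of this form, and its
value is that of one monomial (`exists_leading_term`). Three consequences follow.

The residue field of each `L j` is `K`. The value group of `L j` is generated by values of the `x
i`, and these already occur in `K(x, y)`: the additive map `℘` iterated `T n` times sends `y - S n`
into `K[x, y]`, with value `w (x (n + 1))`. Finally, a translation of `x j` by a constant changes `x
(T n)` and `u` only by constants, hence preserves all values (`value_translate`).

Translation invariance makes `w` Galois invariant, so `g = 1`, and it keeps `x (j + 1)` out of `L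
j`, so each step is an Artin–Schreier extension of degree `p`. Since `e = f = g = 1`, the defect is
`p`.

The pseudo-limit is found in an ultrapower. There `x` and `y` are algebraically independent, and the
valuation is pulled back to the algebraic closure of `K(x, y)`. -/

/-! ### Dominant monomials and substitution in bivariate polynomials. -/

open Polynomial in
/-- If the values of `x` and `u` satisfy `w x = (w u) ^ q` with `w u > 1`, then the monomials
of a polynomial of degree less than `q` in the second variable have pairwise distinct values at
`(x, u)`, so that one of them dominates. -/
theorem Polynomial.exists_dominant_monomial {K : Type*} [Field K] {q : ℕ} {h : K[X][X]}
    (h0 : h ≠ 0) (hq : h.natDegree < q) :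
    ∃ α : K, α ≠ 0 ∧ ∃ a b : ℕ, b < q ∧
      ∀ {Ω Γ : Type*} [Field Ω] [Algebra K Ω] [LinearOrderedCommGroupWithZero Γ]
        (w : Valuation Ω Γ), (∀ c : K, c ≠ 0 → w (algebraMap K Ω c) = 1) →
        ∀ x u : Ω, w x = w u ^ q → 1 < w u →
          w (aevalAeval x u h - algebraMap K Ω α * x ^ a * u ^ b) < w u ^ (a * q + b) := by
  classical
  let S : Finset (Σ _ : ℕ, ℕ) := h.support.sigma fun j => (h.coeff j).support
  have hS : S.Nonempty := by
    obtain ⟨j, hj⟩ := Polynomial.support_nonempty.2 h0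
    obtain ⟨i, hi⟩ := Polynomial.support_nonempty.2 (Polynomial.mem_support_iff.1 hj)
    exact ⟨⟨j, i⟩, Finset.mem_sigma.2 ⟨hj, hi⟩⟩
  -- A pair `⟨j, i⟩` stands for the monomial `x ^ i * u ^ j`, of value `w u ^ (i * q + j)`; since `j
  -- < q`, this exponent determines the pair.
  obtain ⟨s, hs, hmax⟩ := S.exists_max_image (fun s => s.2 * q + s.1) hS
  have hlt : ∀ t ∈ S, t.1 < q := fun t ht =>
    (Polynomial.le_natDegree_of_mem_supp _ (Finset.mem_sigma.1 ht).1).trans_lt hq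
  refine ⟨(h.coeff s.1).coeff s.2, Polynomial.mem_support_iff.1 (Finset.mem_sigma.1 hs).2, s.2,
    s.1, hlt s hs, ?_⟩
  intro Ω Γ _ _ _ w hw x u hx hu
  have hsum : aevalAeval x u h =
      ∑ t ∈ S, algebraMap K Ω ((h.coeff t.1).coeff t.2) * x ^ t.2 * u ^ t.1 := by
    rw [Finset.sum_sigma]
    conv_lhs => rw [h.as_sum_support, map_sum]
    refine Finset.sum_congr rfl fun j _ => ?_
    rw [← C_mul_X_pow_eq_monomial, map_mul, map_pow, aevalAeval_C, aevalAeval_Y, aeval_def,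
      eval₂_eq_sum, Polynomial.sum, Finset.sum_mul]
  rw [hsum, ← Finset.add_sum_erase _ _ hs, add_sub_cancel_left]
  have hu0 : w u ≠ 0 := (zero_lt_one.trans hu).ne'
  refine w.map_sum_lt (pow_ne_zero _ hu0) fun t ht => ?_
  obtain ⟨hts, htS⟩ := Finset.mem_erase.1 ht
  have hval : w (algebraMap K Ω ((h.coeff t.1).coeff t.2) * x ^ t.2 * u ^ t.1) =
      w u ^ (t.2 * q + t.1) := by
    rw [map_mul, map_mul, map_pow, map_pow,
      hw _ (Polynomial.mem_support_iff.1 (Finset.mem_sigma.1 htS).2), hx, one_mul, pow_add,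
      mul_comm t.2 q, pow_mul]
  rw [hval]
  refine pow_lt_pow_right₀ hu (lt_of_le_of_ne (hmax t htS) fun he => hts ?_)
  have h1 : t.1 = s.1 := by
    have := congrArg (· % q) he
    simpa [Nat.mul_add_mod_self_right, Nat.mod_eq_of_lt (hlt t htS), Nat.mod_eq_of_lt (hlt s hs)]
      using this
  have h2 : t.2 = s.2 := by
    have : t.2 * q = s.2 * q := by omega
    exact Nat.eq_of_mul_eq_mul_right ((Nat.zero_le _).trans_lt hq) this
  exact Sigma.ext h1 (heq_of_eq h2)

open Polynomial in
theorem Polynomial.aevalAeval_taylor {K Ω : Type*} [Field K] [Field Ω] [Algebra K Ω] (x u : Ω)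
    (r : K[X]) (g : K[X][X]) :
    aevalAeval x u (taylor r g) = aevalAeval x (u + aeval x r) g := by
  induction g using Polynomial.induction_on' with
  | add p q hp hq => rw [map_add, map_add, map_add, hp, hq]
  | monomial n a =>
    rw [taylor_monomial, ← C_mul_X_pow_eq_monomial]
    simp only [map_mul, map_pow, map_add, aevalAeval_C, aevalAeval_Y]

open Polynomial in
theorem Polynomial.aevalAeval_map {K Ω : Type*} [Field K] [Field Ω] [Algebra K Ω] (x u : Ω)
    (Q : K[X]) (g : K[X][X]) :
    aevalAeval x u (g.map (aeval Q : K[X] →ₐ[K] K[X]).toRingHom) =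
      aevalAeval (aeval x Q) u g := by
  induction g using Polynomial.induction_on' with
  | add p q hp hq => rw [Polynomial.map_add, map_add, map_add, hp, hq]
  | monomial n a =>
    rw [map_monomial, ← C_mul_X_pow_eq_monomial, ← C_mul_X_pow_eq_monomial]
    simp only [map_mul, map_pow, aevalAeval_C, aevalAeval_Y]
    congr 1
    exact (Polynomial.aeval_algHom_apply (aeval x : K[X] →ₐ[K] Ω) Q a).symm ▸ rfl

/-! ### The Artin–Schreier map and valuations. -/

/-- The Artin–Schreier map `z ↦ z ^ p - z`. -/
def artinSchreier (p : ℕ) {R : Type*} [CommRing R] (z : R) : R := z ^ p - z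

namespace artinSchreier

variable (p : ℕ)

theorem map_iterate {R S : Type*} [CommRing R] [CommRing S] {F : Type*} [FunLike F R S]
    [RingHomClass F R S] (f : F) (n : ℕ) (z : R) :
    f ((artinSchreier p)^[n] z) = (artinSchreier p)^[n] (f z) :=
  Function.Semiconj.iterate_right (f := f) (fun z => by simp [artinSchreier]) n z

theorem iterate_add [Fact p.Prime] {R : Type*} [CommRing R] [CharP R p] (n : ℕ) (a b : R) :
    (artinSchreier p)^[n] (a + b) = (artinSchreier p)^[n] a + (artinSchreier p)^[n] b :=
  Function.Semiconj₂.iterate (op := (· + ·))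
    (fun a b => by simp only [artinSchreier, add_pow_char]; ring) n a b

theorem iterate_sub [Fact p.Prime] {R : Type*} [CommRing R] [CharP R p] (n : ℕ) (a b : R) :
    (artinSchreier p)^[n] (a - b) = (artinSchreier p)^[n] a - (artinSchreier p)^[n] b := by
  rw [eq_sub_iff_add_eq, ← iterate_add, sub_add_cancel]

theorem iterate_sum [Fact p.Prime] {R ι : Type*} [CommRing R] [CharP R p] (n : ℕ) (s : Finset ι)
    (f : ι → R) :
    (artinSchreier p)^[n] (∑ i ∈ s, f i) = ∑ i ∈ s, (artinSchreier p)^[n] (f i) := by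
  classical
  induction s using Finset.induction_on with
  | empty =>
    have := iterate_sub p n (0 : R) 0
    simpa using this
  | insert a s ha ih => rw [Finset.sum_insert ha, Finset.sum_insert ha, iterate_add, ih]

theorem surjective_of_isAlgClosed [hp : Fact p.Prime] (K : Type*) [Field K] [IsAlgClosed K] :
    Function.Surjective (artinSchreier p : K → K) := by
  intro a
  have hdeg : ((Polynomial.X : Polynomial K) ^ p - (Polynomial.X + Polynomial.C a)).degree = (p : WithBot ℕ) := by
    rw [Polynomial.degree_sub_eq_left_of_degree_lt, Polynomial.degree_X_pow]
    rw [Polynomial.degree_X_pow, Polynomial.degree_X_add_C]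
    exact_mod_cast hp.out.one_lt
  obtain ⟨z, hz⟩ := IsAlgClosed.exists_root _ (by
    rw [hdeg]; exact_mod_cast hp.out.ne_zero)
  refine ⟨z, ?_⟩
  simp only [Polynomial.IsRoot.def, Polynomial.eval_sub, Polynomial.eval_pow, Polynomial.eval_X,
    Polynomial.eval_add, Polynomial.eval_C] at hz
  rw [artinSchreier]
  linear_combination hz

section Valuation

variable {Ω Γ : Type*} [Field Ω] [LinearOrderedCommGroupWithZero Γ] (w : Valuation Ω Γ)

theorem one_lt_valuation_of_one_lt {z : Ω} (h : 1 < w (artinSchreier p z)) : 1 < w z := by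
  by_contra! hz
  refine h.not_ge ((w.map_sub _ _).trans (max_le ?_ hz))
  rw [map_pow]
  exact pow_le_one' hz p

variable [hp : Fact p.Prime]

theorem valuation_eq {z : Ω} (h : 1 < w z) : w (artinSchreier p z) = w z ^ p := by
  rw [artinSchreier, Valuation.map_sub_eq_of_lt_left, map_pow]
  rw [map_pow]
  exact lt_self_pow₀ h hp.out.one_lt

theorem valuation_iterate {z : Ω} (h : 1 < w z) (n : ℕ) :
    w ((artinSchreier p)^[n] z) = w z ^ p ^ n := by
  induction n with
  | zero => simp
  | succ n ih =>
    rw [Function.iterate_succ_apply', valuation_eq, ih, ← pow_mul, pow_succ]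
    rw [ih]
    exact one_lt_pow₀ h (pow_ne_zero _ hp.out.ne_zero)

end Valuation

end artinSchreier

/-! ### Values of polynomials on the tower. -/

/-- The triangular numbers. -/
def triangular (n : ℕ) : ℕ := ∑ i ∈ Finset.range (n + 1), i

theorem triangular_succ (n : ℕ) : triangular (n + 1) = triangular n + (n + 1) :=
  Finset.sum_range_succ _ _

theorem triangular_mono : Monotone triangular :=
  monotone_nat_of_le_succ fun n => by rw [triangular_succ]; omega

theorem le_triangular (n : ℕ) : n ≤ triangular n := by
  induction n with
  | zero => exact Nat.zero_le _
  | succ n _ => rw [triangular_succ]; omega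

/-- A tower of Artin–Schreier generators `x i` of values `> 1` over the field `K` of constants,
together with a pseudo-limit `y` of the partial sums of the series `∑ x (triangular i)`. -/
structure ArtinSchreierTower (K : Type*) {Ω Γ : Type*} [Field K] [Field Ω] [Algebra K Ω]
    [LinearOrderedCommGroupWithZero Γ] (p : ℕ) (w : Valuation Ω Γ) (x : ℕ → Ω) (y : Ω) : Prop where
  map_const : ∀ c : K, c ≠ 0 → w (algebraMap K Ω c) = 1
  one_lt_zero : 1 < w (x 0)
  step : ∀ i, artinSchreier p (x (i + 1)) = x i
  limit : ∀ n, w (y - ∑ i ∈ Finset.range (n + 1), x (triangular i)) = w (x (triangular (n + 1)))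

namespace ArtinSchreierTower

open Polynomial

variable {K Ω Γ : Type*} [Field K] [Field Ω] [Algebra K Ω] [LinearOrderedCommGroupWithZero Γ]
  {p : ℕ} {w : Valuation Ω Γ} {x : ℕ → Ω} {y : Ω}

theorem one_lt (T : ArtinSchreierTower K p w x y) (i : ℕ) : 1 < w (x i) := by
  induction i with
  | zero => exact T.one_lt_zero
  | succ i ih => exact artinSchreier.one_lt_valuation_of_one_lt p w (by rwa [T.step])

theorem map_const_le (T : ArtinSchreierTower K p w x y) (c : K) : w (algebraMap K Ω c) ≤ 1 := by
  by_cases hc : c = 0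
  · simp [hc]
  · exact (T.map_const c hc).le

theorem map_add_const (T : ArtinSchreierTower K p w x y) {z : Ω} (hz : 1 < w z) (c : K) :
    w (z + algebraMap K Ω c) = w z :=
  Valuation.map_add_eq_of_lt_left _ ((T.map_const_le c).trans_lt hz)

theorem iterate_step (T : ArtinSchreierTower K p w x y) (i m : ℕ) :
    (artinSchreier p)^[m] (x (i + m)) = x i := by
  induction m with
  | zero => rfl
  | succ m ih => rw [Function.iterate_succ_apply, ← add_assoc, T.step, ih]

variable (p K) in
/-- The `n`-th partial sum of the series, as a polynomial in `x (triangular n)`. -/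
noncomputable def partialSum (n : ℕ) : K[X] :=
  ∑ i ∈ Finset.range (n + 1), (artinSchreier p)^[triangular n - triangular i] X

theorem aeval_partialSum (T : ArtinSchreierTower K p w x y) (n : ℕ) :
    aeval (x (triangular n)) (partialSum K p n) =
      ∑ i ∈ Finset.range (n + 1), x (triangular i) := by
  rw [partialSum, map_sum]
  refine Finset.sum_congr rfl fun i hi => ?_
  have hi := triangular_mono (Nat.lt_succ_iff.1 (Finset.mem_range.1 hi))
  rw [artinSchreier.map_iterate, aeval_X]
  conv_lhs => rw [← Nat.add_sub_cancel' hi]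
  rw [Nat.add_sub_cancel_left, T.iterate_step]

variable [hp : Fact p.Prime]

theorem pow_value (T : ArtinSchreierTower K p w x y) (i m : ℕ) :
    w (x (i + m)) ^ p ^ m = w (x i) := by
  rw [← artinSchreier.valuation_iterate p w (T.one_lt _), T.iterate_step]

/-- The partial sums are additive polynomials, because the Artin–Schreier map is additive in
characteristic `p`. -/
theorem aeval_partialSum_add [CharP Ω p] (n : ℕ) (z : Ω) (c : K) :
    aeval (z + algebraMap K Ω c) (partialSum K p n) =
      aeval z (partialSum K p n) + algebraMap K Ω ((partialSum K p n).eval c) := by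
  rw [← Polynomial.coe_aeval_eq_eval, ← Polynomial.aeval_algebraMap_apply]
  simp only [partialSum, map_sum, artinSchreier.map_iterate, aeval_X, artinSchreier.iterate_add,
    Finset.sum_add_distrib]

/-- Rewriting `f` in terms of `z = x (triangular n) + c` and `u = y - S(z)`, with `S` the partial
sum polynomial, is a formal substitution that does not involve `d`. Hence `α`, `a`, `b` serve all
translations `d` at once; only `z` and `u` vary, and their values do not. -/
theorem exists_leading_term [IsAlgClosed K] [CharP Ω p] (T : ArtinSchreierTower K p w x y)
    {f : K[X][X]} (hf : f ≠ 0) {j n : ℕ} (hj : j ≤ n) (hdeg : f.natDegree ≤ n) :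
    ∃ α : K, α ≠ 0 ∧ ∃ a b : ℕ, b < p ^ (n + 1) ∧ ∀ d : K, ∃ z u : Ω,
      w z = w u ^ p ^ (n + 1) ∧ w u = w (x (triangular (n + 1))) ∧
      (d = 0 → z = x (triangular n) ∧
        u = y - ∑ i ∈ Finset.range (n + 1), x (triangular i)) ∧
      w (aevalAeval (x j + algebraMap K Ω d) y f - algebraMap K Ω α * z ^ a * u ^ b) <
        w (x (triangular (n + 1))) ^ (a * p ^ (n + 1) + b) := by
  have hjn : j ≤ triangular n := hj.trans (le_triangular n)
  set m := triangular n - j with hm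
  have hmj : j + m = triangular n := Nat.add_sub_cancel' hjn
  have hsurj := (artinSchreier.surjective_of_isAlgClosed p K).iterate m
  set Q : K[X] := (artinSchreier p)^[m] X with hQ
  have hQe : ∀ {A : Type _} [CommRing A] [Algebra K A] (a : A),
      aeval a Q = (artinSchreier p)^[m] a := fun a => by
    rw [hQ, artinSchreier.map_iterate, aeval_X]
  set φ : K[X] →+* K[X] := (aeval Q : K[X] →ₐ[K] K[X]).toRingHom with hφ
  -- `Q` is surjective as a function on `K`, so `g ∘ Q = 0` forces `g` to vanish on all of the
  -- infinite field `K`.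
  have hφi : Function.Injective φ := by
    rw [injective_iff_map_eq_zero]
    intro g hg
    refine Polynomial.funext fun c => ?_
    obtain ⟨c, rfl⟩ := hsurj c
    have : aeval c (aeval Q g) = 0 := by
      rw [show aeval Q g = 0 from hg, map_zero]
    rw [← Polynomial.aeval_algHom_apply] at this
    rw [artinSchreier.map_iterate, aeval_X] at this
    rw [eval_zero, ← this, Polynomial.coe_aeval_eq_eval]
  set g := f.map φ with hg
  have hg0 : g ≠ 0 := (Polynomial.map_ne_zero_iff hφi).2 hf
  have hgd : g.natDegree = f.natDegree := Polynomial.natDegree_map_eq_of_injective hφi f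
  obtain ⟨α, hα, a, b, hb, H⟩ := Polynomial.exists_dominant_monomial (q := p ^ (n + 1))
    (h := taylor (partialSum K p n) g) (by rwa [Ne, taylor_eq_zero])
    (by
      rw [natDegree_taylor, hgd]
      exact (Nat.lt_succ_of_le hdeg).trans (Nat.lt_pow_self hp.out.one_lt))
  refine ⟨α, hα, a, b, hb, fun d => ?_⟩
  -- Translating `x (triangular n)` by `c` translates `x j` by `d`. For `d = 0` the choice `c = 0`
  -- pins down `z` and `u`, so that they agree for different polynomials.
  obtain ⟨c, hc, hc0⟩ : ∃ c, (artinSchreier p)^[m] c = d ∧ (d = 0 → c = 0) := by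
    by_cases hd : d = 0
    · refine ⟨0, ?_, fun _ => rfl⟩
      rw [hd, Function.iterate_fixed]
      simp [artinSchreier, hp.out.ne_zero]
    · obtain ⟨c, hc⟩ := hsurj d
      exact ⟨c, hc, fun h => absurd h hd⟩
  have hu1 : 1 < w (y - ∑ i ∈ Finset.range (n + 1), x (triangular i)) := by
    rw [T.limit]; exact T.one_lt _
  set z := x (triangular n) + algebraMap K Ω c with hz
  set u := y - aeval z (partialSum K p n) with hu
  have hu' : u = y - ∑ i ∈ Finset.range (n + 1), x (triangular i) +
      algebraMap K Ω (-(partialSum K p n).eval c) := by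
    rw [hu, hz, aeval_partialSum_add, T.aeval_partialSum, map_neg]; ring
  have hwu : w u = w (x (triangular (n + 1))) := by
    rw [hu', T.map_add_const hu1, T.limit]
  have hwz : w z = w u ^ p ^ (n + 1) := by
    rw [hz, T.map_add_const (T.one_lt _), hwu, triangular_succ, T.pow_value]
  refine ⟨z, u, hwz, hwu, fun hd => ?_, ?_⟩
  · have : z = x (triangular n) := by rw [hz, hc0 hd, map_zero, add_zero]
    exact ⟨this, by rw [hu, this, T.aeval_partialSum]⟩
  · have key := H w T.map_const z u hwz (by rw [hwu]; exact T.one_lt _)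
    rw [aevalAeval_taylor, hu, sub_add_cancel, ← hu, hg, hφ, aevalAeval_map, hwu] at key
    convert key using 4
    congr 2
    rw [hQe, hz, artinSchreier.iterate_add, ← hmj, T.iterate_step, ← artinSchreier.map_iterate, hc]

/-- The value of a polynomial in `x j` and `y` does not change if `x j` is translated by
a constant. -/
theorem exists_value_eq [IsAlgClosed K] [CharP Ω p] (T : ArtinSchreierTower K p w x y)
    {f : K[X][X]} (hf : f ≠ 0) (j : ℕ) :
    ∃ n, ∀ m, n ≤ m → ∃ N : ℕ, ∀ d : K,
      w (aevalAeval (x j + algebraMap K Ω d) y f) = w (x (triangular (m + 1))) ^ N := by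
  -- Any larger level works as well, so that two polynomials can be compared at a common one.
  refine ⟨max j f.natDegree, fun m hm => ?_⟩
  obtain ⟨α, hα, a, b, -, H⟩ :=
    T.exists_leading_term hf ((le_max_left _ _).trans hm) ((le_max_right _ _).trans hm)
  refine ⟨a * p ^ (m + 1) + b, fun d => ?_⟩
  obtain ⟨z, u, hz, hu, -, h⟩ := H d
  have hval : w (algebraMap K Ω α * z ^ a * u ^ b) =
      w (x (triangular (m + 1))) ^ (a * p ^ (m + 1) + b) := by
    rw [map_mul, map_mul, map_pow, map_pow, T.map_const α hα, hz, hu, one_mul, ← pow_mul,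
      ← pow_add, mul_comm a]
  rw [← hval] at h ⊢
  have := w.map_add_eq_of_lt_left h
  rwa [add_comm, sub_add_cancel] at this

/-- The exponent supplied by `exists_value_eq` is independent of `d`. This drives both Galois
invariance and the degree computation. -/
theorem value_translate [IsAlgClosed K] [CharP Ω p] (T : ArtinSchreierTower K p w x y)
    (f : K[X][X]) (j : ℕ) (d : K) :
    w (aevalAeval (x j + algebraMap K Ω d) y f) = w (aevalAeval (x j) y f) := by
  by_cases hf : f = 0
  · simp [hf]
  · obtain ⟨n, hn⟩ := T.exists_value_eq hf j
    obtain ⟨N, hN⟩ := hn n le_rfl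
    rw [hN d, ← hN 0, map_zero, add_zero]

theorem aevalAeval_ne_zero [IsAlgClosed K] [CharP Ω p] (T : ArtinSchreierTower K p w x y)
    {f : K[X][X]} (hf : f ≠ 0) (j : ℕ) : aevalAeval (x j) y f ≠ 0 := by
  obtain ⟨n, hn⟩ := T.exists_value_eq hf j
  obtain ⟨N, hN⟩ := hn n le_rfl
  rw [← w.ne_zero_iff]
  have := hN 0
  rw [map_zero, add_zero] at this
  rw [this]
  exact pow_ne_zero _ (zero_lt_one.trans (T.one_lt _)).ne'

/-- The residue field of `K(x j, y)` is `K`. -/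
theorem exists_const_sub_lt [IsAlgClosed K] [CharP Ω p] (T : ArtinSchreierTower K p w x y)
    (f g : K[X][X]) (j : ℕ) (hg : aevalAeval (x j) y g ≠ 0)
    (hle : w (aevalAeval (x j) y f / aevalAeval (x j) y g) ≤ 1) :
    ∃ c : K, w (aevalAeval (x j) y f / aevalAeval (x j) y g - algebraMap K Ω c) < 1 := by
  rcases hle.lt_or_eq with hlt | heq
  · exact ⟨0, by simpa using hlt⟩
  have hf0 : f ≠ 0 := by
    rintro rfl
    simp at heq
  have hg0 : g ≠ 0 := by
    rintro rfl
    simp at hg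
  set n := max j (max f.natDegree g.natDegree) with hn
  obtain ⟨α, hα, a, b, hb, H⟩ := T.exists_leading_term hf0 (n := n) (j := j) (by omega) (by omega)
  obtain ⟨β, hβ, a', b', hb', H'⟩ :=
    T.exists_leading_term hg0 (n := n) (j := j) (by omega) (by omega)
  obtain ⟨z, u, hz, hu, h0, h⟩ := H 0
  obtain ⟨z', u', -, -, h0', h'⟩ := H' 0
  obtain ⟨rfl, rfl⟩ : z' = z ∧ u' = u := by
    rw [(h0 rfl).1, (h0 rfl).2, (h0' rfl).1, (h0' rfl).2]; exact ⟨rfl, rfl⟩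
  rw [map_zero, add_zero, ← hu] at h h'
  have hu1 : 1 < w u' := hu ▸ T.one_lt _
  have hval : ∀ (γ : K) (i k : ℕ), γ ≠ 0 → w (algebraMap K Ω γ * z' ^ i * u' ^ k) =
      w u' ^ (i * p ^ (n + 1) + k) := fun γ i k hγ => by
    rw [map_mul, map_mul, map_pow, map_pow, T.map_const γ hγ, hz, one_mul, ← pow_mul,
      ← pow_add, mul_comm i]
  set A := aevalAeval (x j) y f
  set B := aevalAeval (x j) y g
  have hA : w A = w u' ^ (a * p ^ (n + 1) + b) := by
    rw [← hval α a b hα] at h ⊢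
    have := w.map_add_eq_of_lt_left h
    rwa [add_comm, sub_add_cancel] at this
  have hB : w B = w u' ^ (a' * p ^ (n + 1) + b') := by
    rw [← hval β a' b' hβ] at h' ⊢
    have := w.map_add_eq_of_lt_left h'
    rwa [add_comm, sub_add_cancel] at this
  have hAB : w A = w B := by
    rw [map_div₀] at heq
    exact (div_eq_one_iff_eq (w.ne_zero_iff.2 hg)).1 heq
  have hexp : a * p ^ (n + 1) + b = a' * p ^ (n + 1) + b' :=
    pow_right_injective₀ (zero_lt_one.trans hu1) hu1.ne' (hA.symm.trans (hAB.trans hB))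
  -- Equal values and `b, b' < p ^ (n + 1)` force the same leading monomial, so the residue of the
  -- quotient is the ratio of the leading coefficients.
  obtain rfl : b = b' := by
    have := congrArg (· % p ^ (n + 1)) hexp
    simpa [Nat.mul_add_mod_self_right, Nat.mod_eq_of_lt hb, Nat.mod_eq_of_lt hb'] using this
  obtain rfl : a = a' :=
    Nat.eq_of_mul_eq_mul_right (pow_pos hp.out.pos _) (Nat.add_right_cancel hexp)
  refine ⟨α / β, ?_⟩
  have hβ' : algebraMap K Ω β ≠ 0 := by simpa using hβ
  have hsplit : A / B - algebraMap K Ω (α / β) =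
      ((A - algebraMap K Ω α * z' ^ a * u' ^ b) -
        algebraMap K Ω (α / β) * (B - algebraMap K Ω β * z' ^ a * u' ^ b)) / B := by
    rw [map_div₀]
    field_simp
    ring
  have hB0 : 0 < w B := zero_lt_iff.2 (w.ne_zero_iff.2 hg)
  rw [hsplit, map_div₀, div_lt_one₀ hB0, hB]
  refine (w.map_sub _ _).trans_lt (max_lt h ?_)
  rw [map_mul, T.map_const _ (div_ne_zero hα hβ), one_mul]
  exact h'

/-- The elements of `K[x 0, y]` whose values generate the value group of all `K(x j, y)`. -/
theorem exists_value_eq_of_subring [CharP Ω p] (T : ArtinSchreierTower K p w x y)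
    (R : Subring Ω) (hx : x 0 ∈ R) (hy : y ∈ R) (m : ℕ) : ∃ z ∈ R, w z = w (x (m + 1)) := by
  -- The iterate turns every summand `x (triangular i)` into a polynomial in `x 0`, and raises `w (x
  -- (triangular (m + 1)))` to the power `p ^ triangular m`, which gives `w (x (m + 1))`.
  refine ⟨(artinSchreier p)^[triangular m]
    (y - ∑ i ∈ Finset.range (m + 1), x (triangular i)), ?_, ?_⟩
  · have hmem : ∀ (n : ℕ) {z : Ω}, z ∈ R → (artinSchreier p)^[n] z ∈ R := by
      intro n z hz
      induction n with
      | zero => exact hz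
      | succ n ih =>
        rw [Function.iterate_succ_apply']
        exact R.sub_mem (R.pow_mem ih _) ih
    rw [artinSchreier.iterate_sub, artinSchreier.iterate_sum]
    refine R.sub_mem (hmem _ hy) (R.sum_mem fun i hi => ?_)
    have hi := triangular_mono (Nat.lt_succ_iff.1 (Finset.mem_range.1 hi))
    have := T.iterate_step 0 (triangular i)
    rw [zero_add] at this
    rw [← Nat.sub_add_cancel hi, Function.iterate_add_apply, this]
    exact hmem _ hx
  · have h1 : 1 < w (y - ∑ i ∈ Finset.range (m + 1), x (triangular i)) := by
      rw [T.limit]; exact T.one_lt _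
    rw [artinSchreier.valuation_iterate p w h1, T.limit, triangular_succ, add_comm, T.pow_value]

/-- All fields `K(x j, y)` have the same value group as `K(x 0, y)`. -/
theorem exists_value_eq_of_subfield [IsAlgClosed K] [CharP Ω p] (T : ArtinSchreierTower K p w x y)
    (F : Subfield Ω) (hx : x 0 ∈ F) (hy : y ∈ F) {f g : K[X][X]} (hf : f ≠ 0) (hg : g ≠ 0)
    (j : ℕ) :
    ∃ z ∈ F, w z = w (aevalAeval (x j) y f / aevalAeval (x j) y g) := by
  obtain ⟨n, hn⟩ := T.exists_value_eq hf j
  obtain ⟨n', hn'⟩ := T.exists_value_eq hg j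
  obtain ⟨N, hN⟩ := hn (max n n') (le_max_left _ _)
  obtain ⟨N', hN'⟩ := hn' (max n n') (le_max_right _ _)
  have h := hN 0
  have h' := hN' 0
  rw [map_zero, add_zero] at h h'
  have hpos : 1 ≤ triangular (max n n' + 1) := (Nat.succ_le_succ (Nat.zero_le _)).trans
    (le_triangular _)
  obtain ⟨z, hz, hzw⟩ := T.exists_value_eq_of_subring F.toSubring hx hy
    (triangular (max n n' + 1) - 1)
  rw [Nat.sub_add_cancel hpos] at hzw
  exact ⟨z ^ N / z ^ N', F.div_mem (F.pow_mem hz _) (F.pow_mem hz _), by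
    rw [map_div₀, map_div₀, map_pow, map_pow, h, h', hzw]⟩

/-- The Artin–Schreier generator `x (j + 1)` is not contained in `K(x j, y)`. -/
theorem generator_ne_div [IsAlgClosed K] [CharP Ω p] (T : ArtinSchreierTower K p w x y)
    (f g : K[X][X]) (j : ℕ) (hg : aevalAeval (x j) y g ≠ 0) :
    x (j + 1) ≠ aevalAeval (x j) y f / aevalAeval (x j) y g := by
  intro h
  rw [eq_div_iff hg] at h
  set φ : K[X] →+* K[X] :=
    (aeval (artinSchreier p (X : K[X])) : K[X] →ₐ[K] K[X]).toRingHom with hφ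
  have heval : ∀ (d : K), artinSchreier p d = 0 → ∀ f : K[X][X],
      aevalAeval (x (j + 1) + algebraMap K Ω d) y (f.map φ) = aevalAeval (x j) y f := by
    intro d hd f
    have h1 := artinSchreier.map_iterate p (aeval (x (j + 1) + algebraMap K Ω d)) 1 (X : K[X])
    have h2 := artinSchreier.iterate_add p 1 (x (j + 1)) (algebraMap K Ω d)
    have h3 := artinSchreier.map_iterate p (algebraMap K Ω) 1 d
    simp only [Function.iterate_one] at h1 h2 h3
    rw [hφ, aevalAeval_map, h1, aeval_X, h2, ← h3, hd, map_zero, add_zero, T.step]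
  -- If `x (j + 1)` were `f / g`, then `F` would vanish at `x (j + 1)` but take the nonzero value of
  -- `g` at `x (j + 1) + 1`, as both points lie over `x j`. This contradicts translation invariance.
  set F : K[X][X] := C X * g.map φ - f.map φ with hF
  have hval : ∀ d : K, artinSchreier p d = 0 → aevalAeval (x (j + 1) + algebraMap K Ω d) y F =
      algebraMap K Ω d * aevalAeval (x j) y g := by
    intro d hd
    rw [hF, map_sub, map_mul, aevalAeval_X, heval d hd, heval d hd, ← h]
    ring
  have hd0 : artinSchreier p (0 : K) = 0 := by simp [artinSchreier, hp.out.ne_zero]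
  have hd1 : artinSchreier p (1 : K) = 0 := by simp [artinSchreier]
  have h1 := hval 1 hd1
  have h2 := hval 0 hd0
  rw [map_zero, add_zero, zero_mul] at h2
  rw [map_one, one_mul] at h1
  have h3 := T.value_translate F (j + 1) 1
  rw [h2, map_one, h1, map_zero] at h3
  exact hg (w.zero_iff.1 h3)

end ArtinSchreierTower

/-! ### Artin–Schreier extensions. -/

namespace artinSchreier

variable {p : ℕ} [hp : Fact p.Prime]

theorem eq_zero_iff {E : Type*} [Field E] [CharP E p] {z : E} :
    artinSchreier p z = 0 ↔ ∃ k : ℤ, (k : E) = z := by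
  rw [artinSchreier, sub_eq_zero, ← Subfield.mem_bot_iff_pow_eq_self, mem_bot_iff_intCast p]

open Polynomial in
theorem splits_and_separable {F : Type*} [Field F] [CharP F p] {a ξ : F}
    (h : artinSchreier p ξ = a) :
    (X ^ p - X - C a : F[X]).Splits ∧ (X ^ p - X - C a : F[X]).Separable := by
  refine ⟨?_, ?_⟩
  · have h1 : (X ^ p - X : F[X]).Splits := by
      simpa using (Subfield.splits_bot F p).map (Subfield.subtype _)
    have h2 : (X ^ p - X - C a : F[X]) = (X ^ p - X : F[X]).comp (X - C ξ) := by
      simp only [sub_comp, pow_comp, X_comp, sub_pow_char, ← h, artinSchreier, C_sub, C_pow]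
      ring
    rw [h2]
    exact h1.comp_of_degree_le_one (by rw [degree_X_sub_C])
  · rw [Polynomial.separable_def]
    have : derivative (X ^ p - X - C a : F[X]) = -1 := by
      simp [derivative_X_pow]
    rw [this]
    exact isCoprime_one_right.neg_right

open Polynomial in
theorem adjoin_eq_top {F E : Type*} [Field F] [Field E] [Algebra F E] {a : F} {ξ : E}
    (h : artinSchreier p ξ = algebraMap F E a) (htop : IntermediateField.adjoin F {ξ} = ⊤) :
    Algebra.adjoin F {ξ} = ⊤ := by
  have hlt : (X + C a : F[X]).degree < (X ^ p : F[X]).degree := by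
    rw [degree_X_pow, degree_X_add_C]
    exact_mod_cast hp.out.one_lt
  have hint : IsIntegral F ξ := ⟨X ^ p - (X + C a), (monic_X_pow p).sub_of_left hlt, by
    rw [← aeval_def]
    simp only [map_sub, map_pow, map_add, aeval_X, aeval_C, ← h, artinSchreier]
    ring⟩
  rw [← IntermediateField.adjoin_simple_toSubalgebra_of_isAlgebraic hint.isAlgebraic, htop,
    IntermediateField.top_toSubalgebra]

open Polynomial in
theorem isGalois {F E : Type*} [Field F] [Field E] [Algebra F E] [CharP F p] {a : F} {ξ : E}
    (h : artinSchreier p ξ = algebraMap F E a) (htop : IntermediateField.adjoin F {ξ} = ⊤) :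
    FiniteDimensional F E ∧ IsGalois F E := by
  have : CharP E p := charP_of_injective_algebraMap (algebraMap F E).injective p
  have hmap : (X ^ p - X - C a : F[X]).map (algebraMap F E) =
      (X ^ p - X - C (algebraMap F E a) : E[X]) := by simp
  obtain ⟨h1, h2⟩ := splits_and_separable h
  rw [← hmap] at h1 h2
  have hsep : (X ^ p - X - C a : F[X]).Separable := (separable_map _).1 h2
  have hsplit : (X ^ p - X - C a : F[X]).IsSplittingField F E := by
    refine ⟨h1, ?_⟩
    rw [eq_top_iff, ← adjoin_eq_top h htop]
    refine Algebra.adjoin_mono ?_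
    rw [Set.singleton_subset_iff, mem_rootSet]
    refine ⟨hsep.ne_zero, ?_⟩
    simp only [map_sub, map_pow, aeval_X, aeval_C, ← h, artinSchreier, sub_self]
  exact ⟨IsSplittingField.finiteDimensional E (X ^ p - X - C a : F[X]),
    IsGalois.of_separable_splitting_field hsep⟩

theorem exists_apply_eq {F E : Type*} [Field F] [Field E] [Algebra F E] [CharP E p] {a : F} {ξ : E}
    (h : artinSchreier p ξ = algebraMap F E a) (σ : E →ₐ[F] E) : ∃ k : ℤ, σ ξ = ξ + k := by
  have h1 := iterate_sub p 1 (σ ξ) ξ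
  have h2 := map_iterate p σ 1 ξ
  simp only [Function.iterate_one] at h1 h2
  rw [← h2, h, AlgHom.commutes, sub_self] at h1
  obtain ⟨k, hk⟩ := eq_zero_iff.1 h1
  exact ⟨k, by rw [hk]; ring⟩

/-- The map `σ ↦ σ ξ - ξ` embeds the Galois group in `ZMod p`, so the degree divides `p`; it is not
`1` because `ξ` is not in `F`. -/
theorem finrank_eq {F E : Type*} [Field F] [Field E] [Algebra F E] [CharP F p] {a : F} {ξ : E}
    (h : artinSchreier p ξ = algebraMap F E a) (htop : IntermediateField.adjoin F {ξ} = ⊤)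
    (hξ : ξ ∉ Set.range (algebraMap F E)) : Module.finrank F E = p := by
  have : CharP E p := charP_of_injective_algebraMap (algebraMap F E).injective p
  obtain ⟨_, _⟩ := isGalois h htop
  choose k hk using fun σ : E ≃ₐ[F] E => exists_apply_eq h σ.toAlgHom
  replace hk : ∀ σ : E ≃ₐ[F] E, σ ξ = ξ + k σ := hk
  let f : (E ≃ₐ[F] E) →* Multiplicative (ZMod p) := MonoidHom.mk'
    (fun σ => Multiplicative.ofAdd (k σ : ZMod p)) (by
      intro σ τ
      rw [← ofAdd_add]
      congr 1
      apply (ZMod.castHom dvd_rfl E).injective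
      simp only [map_add, map_intCast]
      have h1 := hk (σ * τ)
      rw [AlgEquiv.mul_apply, hk τ, map_add, hk σ, map_intCast] at h1
      linear_combination -h1)
  have hf : Function.Injective f := by
    intro σ τ hστ
    have h1 : (k σ : E) = k τ := by
      have := congrArg (fun z => ZMod.castHom dvd_rfl E (Multiplicative.toAdd z)) hστ
      simpa [f] using this
    apply AlgEquiv.coe_toAlgHom_injective
    refine AlgHom.ext_of_adjoin_eq_top (adjoin_eq_top h htop) ?_
    rintro _ rfl
    change σ _ = τ _
    rw [hk, hk, h1]
  have hcard := Subgroup.card_dvd_of_injective f hf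
  rw [IsGalois.card_aut_eq_finrank, Nat.card_eq_fintype_card, Fintype.card_multiplicative,
    ZMod.card] at hcard
  refine (hp.out.eq_one_or_self_of_dvd _ hcard).resolve_left fun h1 => hξ ?_
  have := (Subalgebra.bot_eq_top_iff_finrank_eq_one (F := F) (E := E)).2 h1
  exact Algebra.mem_bot.1 (this ▸ Algebra.mem_top)

end artinSchreier

/-! ### Galois-invariant valuations and the defect. -/

namespace ValExt

variable {F E Γ : Type*} [Field F] [Field E] [Algebra F E] [LinearOrderedCommGroupWithZero Γ]
  {w : Valuation E Γ}

open Polynomial in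
/-- If `w` is invariant under the Galois group, every valuation ring of `E` above that of
`w` restricted to `F` contains the valuation ring of `w`. -/
theorem valuationSubring_le_of_comap_eq [FiniteDimensional F E] [IsGalois F E]
    (hinv : ∀ (σ : E ≃ₐ[F] E) z, w (σ z) = w z) {B : ValuationSubring E}
    (hB : B.comap (algebraMap F E) = (restrict F w).valuationSubring) :
    w.valuationSubring ≤ B := by
  intro z hz
  have hz : w z ≤ 1 := hz
  -- All conjugates of `z` are integral by invariance, so `P` has coefficients in the valuation ring
  -- of `F`, hence in `B`. Thus `z` is integral over the integrally closed ring `B`.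
  set P := MulSemiringAction.charpoly (E ≃ₐ[F] E) z with hP
  have hPw : P ∈ Polynomial.lifts (w.valuationSubring.subtype) := by
    rw [hP, MulSemiringAction.charpoly_eq]
    refine Subsemiring.prod_mem _ fun σ _ => ?_
    have hσ : w (σ • z) ≤ 1 := (hinv σ z).trans_le hz
    refine (Polynomial.mem_lifts _).2 ⟨X - C ⟨σ • z, hσ⟩, ?_⟩
    simp
  have hPB : P ∈ Polynomial.lifts (algebraMap B E) := by
    rw [Polynomial.lifts_iff_coeff_lifts] at hPw ⊢
    intro n
    obtain ⟨⟨c, hc⟩, hcP⟩ := hPw n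
    obtain ⟨b, hb⟩ : P.coeff n ∈ Set.range (algebraMap F E) :=
      IsGalois.mem_range_algebraMap_iff_fixed _ |>.2 fun σ =>
        MulSemiringAction.smul_coeff_charpoly z n σ
    have hbF : b ∈ (restrict F w).valuationSubring := by
      change w (algebraMap F E b) ≤ 1
      rw [hb, ← hcP]
      exact hc
    rw [← hB] at hbF
    exact ⟨⟨_, hbF⟩, hb⟩
  obtain ⟨Q, hQ, -, hQm⟩ := Polynomial.lifts_and_degree_eq_and_monic hPB
    (MulSemiringAction.monic_charpoly _ z)
  have hint : IsIntegral B z := ⟨Q, hQm, by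
    rw [← Polynomial.eval_map, hQ, hP, MulSemiringAction.eval_charpoly]⟩
  obtain ⟨b, hb⟩ := IsIntegrallyClosed.isIntegral_iff.1 hint
  rw [← hb]
  exact b.2

/-- A competing ring `B` contains that of `w`. Conversely, for `z ∈ B` choose `b` in `F` of the same
value: `b / z` is a unit for `w`, so `b ∈ B ∩ F` and `w z = w b ≤ 1`. -/
theorem numExtensions_eq_one [FiniteDimensional F E] [IsGalois F E]
    (hinv : ∀ (σ : E ≃ₐ[F] E) z, w (σ z) = w z)
    (hval : ∀ z : E, ∃ b : F, w (algebraMap F E b) = w z) : numExtensions F w = 1 := by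
  rw [numExtensions, Set.ncard_eq_one]
  refine ⟨w.valuationSubring, Set.eq_singleton_iff_unique_mem.2 ⟨rfl, fun B hB => ?_⟩⟩
  have hle := valuationSubring_le_of_comap_eq hinv hB
  refine le_antisymm (fun z hz => ?_) hle
  by_cases hz0 : z = 0
  · rw [hz0]; exact zero_mem _
  obtain ⟨b, hb⟩ := hval z
  have hb0 : w (algebraMap F E b) ≠ 0 := by rw [hb]; exact w.ne_zero_iff.2 hz0
  have hquot : algebraMap F E b / z ∈ B := hle (by
    rw [Valuation.mem_valuationSubring_iff, map_div₀, hb, div_self (hb ▸ hb0)])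
  have hbB : b ∈ B.comap (algebraMap F E) := by
    have := mul_mem hquot hz
    rwa [div_mul_cancel₀ _ hz0] at this
  rw [hB] at hbB
  change w (algebraMap F E b) ≤ 1 at hbB
  rwa [hb] at hbB

theorem isImmediate_of_exists
    (hval : ∀ z : E, ∃ b : F, w (algebraMap F E b) = w z)
    (hres : ∀ z : E, w z ≤ 1 → ∃ c : F, w (z - algebraMap F E c) < 1) : IsImmediate F w := by
  refine ⟨le_antisymm ?_ ?_, ?_⟩
  · rintro _ ⟨b, rfl⟩
    exact ⟨Units.map (algebraMap F E) b, Units.ext rfl⟩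
  · rintro _ ⟨z, rfl⟩
    obtain ⟨b, hb⟩ := hval z
    have hb0 : b ≠ 0 := by
      rintro rfl
      rw [map_zero, map_zero] at hb
      exact z.ne_zero (w.zero_iff.1 hb.symm)
    exact ⟨Units.mk0 b hb0, Units.ext hb⟩
  · intro r
    obtain ⟨⟨z, hz⟩, rfl⟩ := IsLocalRing.residue_surjective r
    obtain ⟨c, hc⟩ := hres z hz
    have hc1 : c ∈ (restrict F w).valuationSubring := by
      have := w.map_sub z (z - algebraMap F E c)
      rw [sub_sub_cancel] at this
      exact this.trans (max_le hz hc.le)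
    refine ⟨IsLocalRing.residue _ ⟨c, hc1⟩, ?_⟩
    rw [IsLocalRing.ResidueField.algebraMap_residue, eq_comm, ← sub_eq_zero, ← map_sub,
      IsLocalRing.residue_eq_zero_iff]
    refine (ValuationSubring.valuation_lt_one_iff _ _).2 ?_
    exact (Valuation.isEquiv_iff_val_lt_one.1 (Valuation.isEquiv_valuation_valuationSubring w)).1 hc

theorem isImmediateGaloisOfDegreeDefect [FiniteDimensional F E] [IsGalois F E]
    (hinv : ∀ (σ : E ≃ₐ[F] E) z, w (σ z) = w z)
    (hval : ∀ z : E, ∃ b : F, w (algebraMap F E b) = w z)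
    (hres : ∀ z : E, w z ≤ 1 → ∃ c : F, w (z - algebraMap F E c) < 1) :
    IsImmediateGaloisOfDegreeDefect F w (Module.finrank F E) (Module.finrank F E) := by
  have himm := isImmediate_of_exists hval hres
  have he : ramificationIndex F w = 1 := by
    rw [ramificationIndex, himm.1, Subgroup.relIndex_self]
  have hf : inertiaDegree F w = 1 := by
    rw [inertiaDegree, ← Subalgebra.bot_eq_top_iff_finrank_eq_one]
    exact (Algebra.surjective_algebraMap_iff).1 himm.2 |>.symm
  refine ⟨‹_›, ‹_›, rfl, himm, ?_⟩
  rw [defect, he, hf, numExtensions_eq_one hinv hval]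
  simp

end ValExt

/-! ### Construction of the pseudo-limit in an ultrapower. -/

section Ultrapower

open Filter

/-- The ultrapower of a valuation ring. -/
def ValuationSubring.germ {ι M : Type*} [Field M] (U : Ultrafilter ι) (V : ValuationSubring M) :
    ValuationSubring ((U : Filter ι).Germ M) where
  carrier := {f | f.LiftPred (· ∈ V)}
  mul_mem' {f g} := Germ.inductionOn₂ f g fun _ _ hf hg => hf.mp (hg.mono fun _ h h' => V.mul_mem _ _ h' h)
  one_mem' := Eventually.of_forall fun _ => V.one_mem
  add_mem' {f g} := Germ.inductionOn₂ f g fun _ _ hf hg => hf.mp (hg.mono fun _ h h' => V.add_mem _ _ h' h)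
  zero_mem' := Eventually.of_forall fun _ => V.zero_mem
  neg_mem' {f} := Germ.inductionOn f fun _ hf => hf.mono fun _ h => V.neg_mem _ h
  mem_or_inv_mem' f := Germ.inductionOn f fun f =>
    Ultrafilter.eventually_or.1 (Eventually.of_forall fun i => V.mem_or_inv_mem (f i))

theorem ValuationSubring.coe_mem_germ {ι M : Type*} [Field M] {U : Ultrafilter ι}
    {V : ValuationSubring M} {f : ι → M} :
    (f : (U : Filter ι).Germ M) ∈ V.germ U ↔ ∀ᶠ i in U, f i ∈ V :=
  Germ.liftPred_coe

theorem ValuationSubring.germ_valuation_le {ι M : Type*} [Field M] {U : Ultrafilter ι}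
    {V : ValuationSubring M} {f g : ι → M}
    (hg : ∀ᶠ i in U, g i ≠ 0) (h : ∀ᶠ i in U, V.valuation (f i) ≤ V.valuation (g i)) :
    (V.germ U).valuation (f : (U : Filter ι).Germ M) ≤ (V.germ U).valuation ↑g := by
  have hg0 : (g : (U : Filter ι).Germ M) ≠ 0 := by
    intro h0
    obtain ⟨i, hi, hi'⟩ := ((Germ.coe_eq.1 h0).and hg).exists
    exact hi' hi
  have hpos : 0 < (V.germ U).valuation (g : (U : Filter ι).Germ M) :=
    zero_lt_iff.2 ((V.germ U).valuation.ne_zero_iff.2 hg0)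
  rw [← div_le_one₀ hpos, ← map_div₀, ValuationSubring.valuation_le_one_iff, ← Germ.coe_div,
    ValuationSubring.coe_mem_germ]
  refine h.mono fun i hi => ?_
  rw [← ValuationSubring.valuation_le_one_iff, Pi.div_apply, map_div₀]
  exact div_le_one_of_le₀ hi zero_le

instance Filter.Germ.isAlgClosed {ι M : Type*} [Field M] [IsAlgClosed M] (U : Ultrafilter ι) :
    IsAlgClosed ((U : Filter ι).Germ M) := by
  refine IsAlgClosed.of_exists_root _ fun P hP hirr => ?_
  choose f hf using fun n => Quotient.exists_rep (P.coeff n)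
  replace hf : ∀ n, ((f n : ι → M) : (U : Filter ι).Germ M) = P.coeff n := hf
  have hd : P.natDegree ≠ 0 := hirr.natDegree_pos.ne'
  -- The instance of Łoś's theorem needed here: a monic polynomial over the ultrapower is
  -- represented by monic polynomials of the same degree over `M`, whose roots are chosen index by
  -- index.
  have hroot : ∀ i, ∃ r : M, r ^ P.natDegree + ∑ n ∈ Finset.range P.natDegree, f n i * r ^ n = 0 := by
    intro i
    set S : Polynomial M := ∑ n ∈ Finset.range P.natDegree,
      Polynomial.C (f n i) * Polynomial.X ^ n with hS
    have hlt : S.degree < (Polynomial.X ^ P.natDegree : Polynomial M).degree := by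
      rw [Polynomial.degree_X_pow]
      refine (Polynomial.degree_sum_le _ _).trans_lt ?_
      rw [Finset.sup_lt_iff (WithBot.bot_lt_coe _)]
      intro n hn
      refine (Polynomial.degree_C_mul_X_pow_le _ _).trans_lt ?_
      exact_mod_cast Finset.mem_range.1 hn
    obtain ⟨r, hr⟩ := IsAlgClosed.exists_root (Polynomial.X ^ P.natDegree + S) (by
      rw [Polynomial.degree_add_eq_left_of_degree_lt hlt, Polynomial.degree_X_pow]
      exact_mod_cast hd)
    refine ⟨r, ?_⟩
    simpa [hS, Polynomial.eval_finsetSum] using hr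
  choose r hr using hroot
  refine ⟨(r : (U : Filter ι).Germ M), ?_⟩
  rw [Polynomial.eval_eq_sum_range, Finset.sum_range_succ, hP.coeff_natDegree, one_mul]
  simp only [← hf]
  have : ((r ^ P.natDegree + ∑ n ∈ Finset.range P.natDegree, f n * r ^ n : ι → M) :
      (U : Filter ι).Germ M) = 0 := by
    have h0 : (r ^ P.natDegree + ∑ n ∈ Finset.range P.natDegree, f n * r ^ n : ι → M) = 0 := by
      funext i
      simpa using hr i
    rw [h0]; rfl
  rw [← this, add_comm]
  push_cast
  congr 1
  exact (map_sum (Germ.coeRingHom (U : Filter ι) : (ι → M) →+* _) _ _).symm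

/-- On a field containing an element that is transcendental over an algebraically closed subfield
there is a valuation ring that contains the subfield, but not the element. -/
theorem exists_valuationSubring_of_notMem_range {K M : Type*} [Field K] [IsAlgClosed K] [Field M]
    [Algebra K M] {x : M} (hx : x ∉ (algebraMap K M).range) :
    ∃ V : ValuationSubring M, (∀ c : K, algebraMap K M c ∈ V) ∧ x ∉ V := by
  -- An algebraically closed field is integrally closed in every extension field, and an element
  -- outside an integrally closed subring is avoided by some valuation ring above it.
  have : IsIntegrallyClosedIn (algebraMap K M).range M := by
    refine Subring.isIntegrallyClosedIn_iff.2 fun {z} hz => ?_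
    obtain ⟨Q, hQ, hQz⟩ := hz
    obtain ⟨P, rfl, -, hP⟩ := Polynomial.lifts_and_degree_eq_and_monic
      (f := (algebraMap K M).rangeRestrict)
      ((Polynomial.mem_lifts _).2 (Polynomial.map_surjective _ (RingHom.rangeRestrict_surjective _) Q))
      hQ
    have hint : IsIntegral K z := ⟨P, hP, by rw [Polynomial.eval₂_map] at hQz; exact hQz⟩
    exact minpoly.mem_range_of_degree_eq_one K z
      (IsAlgClosed.degree_eq_one_of_irreducible K (minpoly.irreducible hint))
  obtain ⟨V, hV, hxV⟩ := Subring.exists_le_valuationSubring_of_isIntegrallyClosedIn hx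
  exact ⟨V, fun c => hV ⟨c, rfl⟩, hxV⟩

/-- Along a nonprincipal ultrafilter, the class of the sequence of partial sums is a pseudo-limit:
the `n`-th condition holds at every index `m > n`. The element `x₀` only serves to give a valuation
ring that contains `K` and omits some element. -/
theorem ArtinSchreierTower.exists_of_isAlgClosed {K M : Type u} [Field K] [IsAlgClosed K] [Field M]
    [IsAlgClosed M] [Algebra K M] {p : ℕ} [hp : Fact p.Prime] {x₀ : M}
    (hx₀ : x₀ ∉ (algebraMap K M).range) :
    ∃ (Ω : Type u) (_ : Field Ω) (_ : Algebra K Ω) (_ : IsAlgClosed Ω) (Γ : Type u)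
      (_ : LinearOrderedCommGroupWithZero Γ) (w : Valuation Ω Γ) (x : ℕ → Ω) (y : Ω),
      ArtinSchreierTower K p w x y := by
  obtain ⟨V, hKV, hxV⟩ := exists_valuationSubring_of_notMem_range hx₀
  set v := V.valuation with hv
  choose ρ hρ using artinSchreier.surjective_of_isAlgClosed p M
  set x : ℕ → M := fun n => ρ^[n] x₀ with hx
  have hstep : ∀ i, artinSchreier p (x (i + 1)) = x i := fun i => by
    simp only [hx, Function.iterate_succ_apply', hρ]
  have hone : ∀ i, 1 < v (x i) := by
    intro i
    induction i with
    | zero => rw [← not_le, hv, ValuationSubring.valuation_le_one_iff]; exact hxV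
    | succ i ih => exact artinSchreier.one_lt_valuation_of_one_lt p v (by rwa [hstep])
  have hanti : StrictAnti fun i => v (x i) := by
    refine strictAnti_nat_of_succ_lt fun i => ?_
    rw [← hstep i, artinSchreier.valuation_eq p v (hone _)]
    exact lt_self_pow₀ (hone _) hp.out.one_lt
  have hne : ∀ i, x i ≠ 0 := fun i => v.ne_zero_iff.1 (zero_lt_one.trans (hone i)).ne'
  have hlim : ∀ n m, n < m → v (∑ i ∈ Finset.range (m + 1), x (triangular i) -
      ∑ i ∈ Finset.range (n + 1), x (triangular i)) = v (x (triangular (n + 1))) := by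
    intro n m hnm
    rw [← Finset.sum_Ico_eq_sub _ (Nat.succ_le_succ hnm.le),
      Finset.sum_eq_sum_Ico_succ_bot (Nat.succ_lt_succ hnm)]
    refine Valuation.map_add_eq_of_lt_left _ (v.map_sum_lt (v.ne_zero_iff.2 (hne _)) fun i hi => ?_)
    refine hanti (lt_of_lt_of_le ?_ (triangular_mono (Finset.mem_Ico.1 hi).1))
    rw [Nat.succ_eq_add_one, triangular_succ (n + 1)]
    omega
  let U : Ultrafilter ℕ := hyperfilter ℕ
  let φ : M →+* (U : Filter ℕ).Germ M :=
    (Germ.coeRingHom (U : Filter ℕ) : (ℕ → M) →+* _).comp (Pi.constRingHom ℕ M)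
  let y : (U : Filter ℕ).Germ M :=
    ((fun m => ∑ i ∈ Finset.range (m + 1), x (triangular i) : ℕ → M) : (U : Filter ℕ).Germ M)
  let _ : Algebra K ((U : Filter ℕ).Germ M) := (φ.comp (algebraMap K M)).toAlgebra
  have hφ : ∀ z, φ z ∈ V.germ U ↔ z ∈ V := fun z =>
    ValuationSubring.coe_mem_germ.trans (eventually_const (p := z ∈ V))
  refine ⟨(U : Filter ℕ).Germ M, inferInstance, inferInstance, inferInstance,
    (V.germ U).ValueGroup, inferInstance, (V.germ U).valuation, fun i => φ (x i), y, ?_, ?_, ?_, ?_⟩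
  · intro c hc
    have hle : ∀ c : K, (V.germ U).valuation (φ (algebraMap K M c)) ≤ 1 := fun c =>
      (ValuationSubring.valuation_le_one_iff _ _).2 ((hφ _).2 (hKV c))
    refine le_antisymm (hle c) ?_
    have h1 := hle c⁻¹
    rw [map_inv₀, map_inv₀, map_inv₀] at h1
    refine (inv_le_one₀ (zero_lt_iff.2 ?_)).1 h1
    exact (Valuation.ne_zero_iff _).2 ((map_ne_zero φ).2 ((map_ne_zero (algebraMap K M)).2 hc))
  · rw [← not_le, ValuationSubring.valuation_le_one_iff, hφ]
    exact hxV
  · intro i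
    rw [← hstep i]
    exact (artinSchreier.map_iterate p φ 1 (x (i + 1))).symm
  · intro n
    have hcoe : y - ∑ i ∈ Finset.range (n + 1), φ (x (triangular i)) =
        ((fun m => ∑ i ∈ Finset.range (m + 1), x (triangular i) -
          ∑ i ∈ Finset.range (n + 1), x (triangular i) : ℕ → M) : (U : Filter ℕ).Germ M) := by
      rw [← map_sum]; rfl
    have hev : ∀ᶠ m in (U : Filter ℕ), v (∑ i ∈ Finset.range (m + 1), x (triangular i) -
        ∑ i ∈ Finset.range (n + 1), x (triangular i)) = v (x (triangular (n + 1))) :=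
      Nat.hyperfilter_le_atTop ((eventually_gt_atTop n).mono fun m hm => hlim n m hm)
    rw [hcoe]
    refine le_antisymm ?_ ?_
    · exact ValuationSubring.germ_valuation_le (g := fun _ => x (triangular (n + 1)))
        (Eventually.of_forall fun _ => hne _) (hev.mono fun m hm => hm.le)
    · exact ValuationSubring.germ_valuation_le (f := fun _ => x (triangular (n + 1)))
        (hev.mono fun m hm => v.ne_zero_iff.1 (hm ▸ v.ne_zero_iff.2 (hne _)))
        (hev.mono fun m hm => hm.ge)

end Ultrapower

/-! ### The fields `K(x i, y)` as valued fields. -/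

open Polynomial in
theorem Polynomial.map_aevalAeval {K A B : Type*} [Field K] [Field A] [Field B] [Algebra K A]
    [Algebra K B] (φ : A →ₐ[K] B) (a b : A) (f : K[X][X]) :
    φ (aevalAeval a b f) = aevalAeval (φ a) (φ b) f := by
  induction f using Polynomial.induction_on' with
  | add p q hp hq => rw [map_add, map_add, map_add, hp, hq]
  | monomial n c =>
    rw [← C_mul_X_pow_eq_monomial]
    simp only [map_mul, map_pow, aevalAeval_C, aevalAeval_Y, Polynomial.aeval_algHom_apply]

namespace ArtinSchreierTower

open Polynomial

theorem of_comap {K Ω Ω' Γ : Type*} [Field K] [Field Ω] [Field Ω'] [Algebra K Ω] [Algebra K Ω']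
    [LinearOrderedCommGroupWithZero Γ] {p : ℕ} {w : Valuation Ω' Γ} (φ : Ω →ₐ[K] Ω') {x : ℕ → Ω}
    {y : Ω} (T : ArtinSchreierTower K p w (fun i => φ (x i)) (φ y)) :
    ArtinSchreierTower K p (w.comap (φ : Ω →+* Ω')) x y where
  map_const c hc := by
    rw [Valuation.comap_apply, RingHom.coe_coe, φ.commutes]
    exact T.map_const c hc
  one_lt_zero := T.one_lt_zero
  step i := φ.injective ((artinSchreier.map_iterate p φ 1 (x (i + 1))).trans (T.step i))
  limit n := by
    simpa only [Valuation.comap_apply, RingHom.coe_coe, map_sub, map_sum] using T.limit n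

theorem adjoin_le (k : Type*) {K Ω Γ : Type*} [Field K] [Field k] [Field Ω] [Algebra k Ω]
    [Algebra K Ω] [LinearOrderedCommGroupWithZero Γ] {p : ℕ} {w : Valuation Ω Γ} {x : ℕ → Ω} {y : Ω}
    (T : ArtinSchreierTower K p w x y) (i : ℕ) :
    IntermediateField.adjoin k {x i} ≤ IntermediateField.adjoin k {x (i + 1)} := by
  have hmem := IntermediateField.mem_adjoin_simple_self k (x (i + 1))
  rw [IntermediateField.adjoin_simple_le_iff, ← T.step i]
  exact sub_mem (pow_mem hmem _) hmem

variable {K k Ω Γ : Type*} [Field K] [Field k] [Field Ω] [Algebra K k] [Algebra k Ω] [Algebra K Ω]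
  [IsScalarTower K k Ω] [LinearOrderedCommGroupWithZero Γ] {p : ℕ} {w : Valuation Ω Γ}
  {x : ℕ → Ω} {y : Ω}

theorem exists_eq_div (T : ArtinSchreierTower K p w x y) {x₀ y₀ : k}
    (hx : algebraMap k Ω x₀ = x 0) (hy : algebraMap k Ω y₀ = y)
    (hk : ∀ z : k, ∃ f g : K[X][X], z = aevalAeval x₀ y₀ f / aevalAeval x₀ y₀ g)
    {i : ℕ} {z : Ω} (hz : z ∈ IntermediateField.adjoin k {x i}) :
    ∃ f g : K[X][X], aevalAeval (x i) y g ≠ 0 ∧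
      z = aevalAeval (x i) y f / aevalAeval (x i) y g := by
  set R : Subring Ω := (aevalAeval (x i) y : K[X][X] →ₐ[K] Ω).toRingHom.range with hR
  have hzR : z ∈ Subfield.closure (R : Set Ω) := by
    have hle : Subfield.closure (Set.range (algebraMap k Ω) ∪ {x i}) ≤
        Subfield.closure (R : Set Ω) := by
      rw [Subfield.closure_le, Set.union_subset_iff, Set.singleton_subset_iff]
      refine ⟨?_, Subfield.subset_closure ⟨C X, aevalAeval_X _ _⟩⟩
      rintro _ ⟨t, rfl⟩
      obtain ⟨f, g, rfl⟩ := hk t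
      have hmem : ∀ f : K[X][X], algebraMap k Ω (aevalAeval x₀ y₀ f) ∈
          Subfield.closure (R : Set Ω) := fun f => by
        have h0 := T.iterate_step 0 i
        rw [zero_add] at h0
        refine Subfield.subset_closure
          ⟨f.map (aeval ((artinSchreier p)^[i] X) : K[X] →ₐ[K] K[X]).toRingHom, ?_⟩
        rw [← IsScalarTower.coe_toAlgHom' K k Ω, map_aevalAeval]
        refine (aevalAeval_map _ _ _ _).trans ?_
        rw [artinSchreier.map_iterate, aeval_X, h0, IsScalarTower.coe_toAlgHom', hx, hy]
      rw [map_div₀]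
      exact Subfield.div_mem _ (hmem f) (hmem g)
    exact hle hz
  rw [Subfield.mem_closure_iff, Subring.closure_eq] at hzR
  obtain ⟨_, ⟨f, rfl⟩, _, ⟨g, rfl⟩, rfl⟩ := hzR
  -- The denominator found in the closure may vanish; the quotient is then `0` by convention and is
  -- rewritten as `0 / 1`.
  by_cases hg : aevalAeval (x i) y g = 0
  · refine ⟨0, 1, by simp, ?_⟩
    change aevalAeval (x i) y f / aevalAeval (x i) y g = _
    rw [hg, div_zero, map_zero, zero_div]
  · exact ⟨f, g, hg, rfl⟩

theorem isImmediateGaloisOfDegreeDefect [hp : Fact p.Prime] [CharP K p] [IsAlgClosed K]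
    (T : ArtinSchreierTower K p w x y) {x₀ y₀ : k}
    (hx : algebraMap k Ω x₀ = x 0) (hy : algebraMap k Ω y₀ = y)
    (hk : ∀ z : k, ∃ f g : K[X][X], z = aevalAeval x₀ y₀ f / aevalAeval x₀ y₀ g) (i : ℕ)
    {F : IntermediateField k Ω} {E : IntermediateField F Ω}
    (hF : F = IntermediateField.adjoin k {x i})
    (hE : E.restrictScalars k = IntermediateField.adjoin k {x (i + 1)}) :
    ValExt.IsImmediateGaloisOfDegreeDefect F (ValExt.restrict E w) p p := by
  have _ : CharP Ω p := charP_of_injective_algebraMap (algebraMap K Ω).injective p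
  have _ : CharP F p := charP_of_injective_algebraMap (algebraMap K F).injective p
  have _ : IsScalarTower K F Ω := .of_algebraMap_eq fun _ => rfl
  have _ : CharP E p := charP_of_injective_algebraMap (algebraMap K E).injective p
  have hxF : x i ∈ F := hF ▸ IntermediateField.mem_adjoin_simple_self k _
  have hxE : x (i + 1) ∈ E.restrictScalars k :=
    hE ▸ IntermediateField.mem_adjoin_simple_self k _
  have hFfrac : ∀ z : F, ∃ f g : K[X][X], aevalAeval (x i) y g ≠ 0 ∧
      z = aevalAeval (x i) y f / aevalAeval (x i) y g := fun z =>
    T.exists_eq_div hx hy hk (hF ▸ z.2)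
  have hEfrac : ∀ z : E, ∃ f g : K[X][X], aevalAeval (x (i + 1)) y g ≠ 0 ∧
      z = aevalAeval (x (i + 1)) y f / aevalAeval (x (i + 1)) y g := fun z =>
    T.exists_eq_div hx hy hk (hE ▸ (show (z : Ω) ∈ E.restrictScalars k from z.2))
  let ξ : E := ⟨x (i + 1), hxE⟩
  let η : E := algebraMap k E y₀
  have hξ : artinSchreier p ξ =
      algebraMap F E ⟨x i, hxF⟩ :=
    Subtype.ext (T.step i)
  have htop : IntermediateField.adjoin F {ξ} = ⊤ := by
    apply IntermediateField.lift_injective E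
    rw [IntermediateField.lift_adjoin_simple, IntermediateField.lift_top]
    apply IntermediateField.restrictScalars_injective k
    rw [hE, IntermediateField.restrictScalars_adjoin]
    refine le_antisymm (IntermediateField.adjoin_le_iff.2 (Set.union_subset ?_ ?_))
      (IntermediateField.adjoin.mono _ _ _ Set.subset_union_right)
    · rw [hF]; exact T.adjoin_le k i
    · exact IntermediateField.subset_adjoin _ _
  obtain ⟨_, _⟩ := artinSchreier.isGalois hξ htop
  have hfin : Module.finrank F E = p := by
    refine artinSchreier.finrank_eq hξ htop ?_
    rintro ⟨z, hz⟩
    obtain ⟨f, g, hg, hfg⟩ := hFfrac z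
    exact T.generator_ne_div f g i hg (hfg ▸ (congrArg Subtype.val hz).symm)
  have hval : ∀ (a b : E) (f : K[X][X]),
      ((aevalAeval a b f : E) : Ω) = aevalAeval (a : Ω) (b : Ω) f := fun a b f =>
    map_aevalAeval (E.val.restrictScalars K) a b f
  have hη : (η : Ω) = y := hy
  have key := ValExt.isImmediateGaloisOfDegreeDefect (F := F) (E := E) (w := ValExt.restrict E w)
    ?_ ?_ ?_
  · rwa [hfin] at key
  -- An automorphism moves the generator by an element of the prime field and fixes `y`, so
  -- `value_translate` applies to numerator and denominator.
  · intro σ z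
    obtain ⟨f, g, hg, hfg⟩ := hEfrac z
    have hz : z = aevalAeval ξ η f / aevalAeval ξ η g := by
      apply Subtype.ext
      rw [hfg]
      push_cast
      rw [hval, hval, hη]
    obtain ⟨m, hm⟩ := artinSchreier.exists_apply_eq hξ σ.toAlgHom
    have hση : σ η = η := σ.toAlgHom.commutes (algebraMap k F y₀)
    have hσ : ∀ f : K[X][X], ((σ (aevalAeval ξ η f) : E) : Ω) =
        aevalAeval (x (i + 1) + algebraMap K Ω m) y f := by
      intro f
      have h1 := map_aevalAeval (σ.toAlgHom.restrictScalars K) ξ η f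
      have h2 : (σ.toAlgHom.restrictScalars K) ξ = ξ + (m : E) := hm
      have h3 : (σ.toAlgHom.restrictScalars K) η = η := hση
      rw [h2, h3] at h1
      refine (congrArg Subtype.val h1).trans ?_
      rw [hval, hη, map_intCast]
      rfl
    change w (σ z : E) = w z
    rw [hfg, hz, map_div₀]
    push_cast
    rw [hσ, hσ, map_div₀, map_div₀, T.value_translate, T.value_translate]
  · intro z
    obtain ⟨f, g, hg, hfg⟩ := hEfrac z
    by_cases hz : (z : Ω) = 0
    · refine ⟨0, ?_⟩
      have : z = 0 := Subtype.ext hz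
      rw [this, map_zero]
    have hf : f ≠ 0 := by
      rintro rfl
      exact hz (by rw [hfg, map_zero, zero_div])
    have hg0 : g ≠ 0 := by
      rintro rfl
      exact hg (map_zero _)
    obtain ⟨b, hb, hbw⟩ := T.exists_value_eq_of_subfield F.toSubfield
      (hx ▸ F.algebraMap_mem x₀) (hy ▸ F.algebraMap_mem y₀) hf hg0 (i + 1)
    refine ⟨⟨b, hb⟩, ?_⟩
    change w b = w z
    rw [hbw, hfg]
  · intro z hz
    obtain ⟨f, g, hg, hfg⟩ := hEfrac z
    change w z ≤ 1 at hz
    rw [hfg] at hz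
    obtain ⟨c, hc⟩ := T.exists_const_sub_lt f g (i + 1) hg hz
    refine ⟨algebraMap K F c, ?_⟩
    rw [← hfg] at hc
    exact hc

end ArtinSchreierTower

/-! ### Descent to the algebraic closure of the rational function field. -/

open Polynomial in
theorem MvPolynomial.aeval_fin_two {K A : Type*} [Field K] [CommRing A] [Algebra K A]
    (a b : A) (f : K[X][X]) :
    MvPolynomial.aeval ![a, b] (Bivariate.equivMvPolynomial K f) = aevalAeval a b f := by
  have : ((MvPolynomial.aeval ![a, b]).comp (Bivariate.equivMvPolynomial K).toAlgHom :
      K[X][X] →ₐ[K] A) = aevalAeval a b := by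
    ext <;> simp
  exact DFunLike.congr_fun this f

/-- Nonzero polynomials in `x 0` and `y` have nonzero value. This embeds the rational function field
in `Ω`. -/
theorem ArtinSchreierTower.injective_aeval {K Ω Γ : Type*} [Field K] [Field Ω] [Algebra K Ω]
    [LinearOrderedCommGroupWithZero Γ] {p : ℕ} [hp : Fact p.Prime] [CharP K p] [IsAlgClosed K]
    {w : Valuation Ω Γ} {x : ℕ → Ω} {y : Ω} (T : ArtinSchreierTower K p w x y) :
    Function.Injective (MvPolynomial.aeval (R := K) ![x 0, y]) := by
  have _ : CharP Ω p := charP_of_injective_algebraMap (algebraMap K Ω).injective p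
  rw [injective_iff_map_eq_zero]
  intro f hf
  obtain ⟨f, rfl⟩ := (Polynomial.Bivariate.equivMvPolynomial K).surjective f
  rw [MvPolynomial.aeval_fin_two] at hf
  by_contra h
  exact T.aevalAeval_ne_zero (fun h0 => h (by rw [h0, map_zero])) 0 hf

theorem RatFunc₂.exists_eq_div {K : Type*} [Field K] (z : RatFunc₂ K) :
    ∃ f g : Polynomial (Polynomial K),
      z = Polynomial.aevalAeval (algebraMap (MvPolynomial (Fin 2) K) (RatFunc₂ K) (MvPolynomial.X 0))
          (algebraMap (MvPolynomial (Fin 2) K) (RatFunc₂ K) (MvPolynomial.X 1)) f /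
        Polynomial.aevalAeval (algebraMap (MvPolynomial (Fin 2) K) (RatFunc₂ K) (MvPolynomial.X 0))
          (algebraMap (MvPolynomial (Fin 2) K) (RatFunc₂ K) (MvPolynomial.X 1)) g := by
  have key : ∀ f : Polynomial (Polynomial K),
      algebraMap (MvPolynomial (Fin 2) K) (RatFunc₂ K)
        (Polynomial.Bivariate.equivMvPolynomial K f) =
      Polynomial.aevalAeval (algebraMap (MvPolynomial (Fin 2) K) (RatFunc₂ K) (MvPolynomial.X 0))
          (algebraMap (MvPolynomial (Fin 2) K) (RatFunc₂ K) (MvPolynomial.X 1)) f := fun f => by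
    rw [← MvPolynomial.aeval_fin_two]
    refine DFunLike.congr_fun (F := MvPolynomial (Fin 2) K →ₐ[K] RatFunc₂ K)
      (f := IsScalarTower.toAlgHom K (MvPolynomial (Fin 2) K) (RatFunc₂ K)) ?_ _
    ext i
    fin_cases i <;> simp
  obtain ⟨f, g, -, rfl⟩ := IsFractionRing.div_surjective (A := MvPolynomial (Fin 2) K) z
  obtain ⟨f, rfl⟩ := (Polynomial.Bivariate.equivMvPolynomial K).surjective f
  obtain ⟨g, rfl⟩ := (Polynomial.Bivariate.equivMvPolynomial K).surjective g
  exact ⟨f, g, by rw [key, key]⟩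

theorem RatFunc₂.X_notMem_range {K : Type*} [Field K] :
    algebraMap (RatFunc₂ K) (AlgebraicClosure (RatFunc₂ K))
      (algebraMap (MvPolynomial (Fin 2) K) _ (MvPolynomial.X 0)) ∉
        (algebraMap K (AlgebraicClosure (RatFunc₂ K))).range := by
  rintro ⟨c, hc⟩
  rw [IsScalarTower.algebraMap_apply K (RatFunc₂ K),
    IsScalarTower.algebraMap_apply K (MvPolynomial (Fin 2) K) (RatFunc₂ K)] at hc
  have h := IsFractionRing.injective (MvPolynomial (Fin 2) K) (RatFunc₂ K)
    ((algebraMap (RatFunc₂ K) (AlgebraicClosure (RatFunc₂ K))).injective hc)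
  have := congrArg MvPolynomial.totalDegree h
  rw [MvPolynomial.totalDegree_X, MvPolynomial.algebraMap_eq, MvPolynomial.totalDegree_C] at this
  exact zero_ne_one this

/-- An algebraic closure of `K(x, y)` carries an Artin–Schreier tower that starts with `x`
and has the pseudo-limit `y`. -/
theorem ArtinSchreierTower.exists_on_algebraicClosure (K : Type u) [Field K] [IsAlgClosed K] (p : ℕ)
    [hp : Fact p.Prime] [CharP K p] :
    ∃ (Γ : Type u) (_ : LinearOrderedCommGroupWithZero Γ)
      (w : Valuation (AlgebraicClosure (RatFunc₂ K)) Γ) (ξ : ℕ → AlgebraicClosure (RatFunc₂ K)),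
      ξ 0 = algebraMap (RatFunc₂ K) _ (algebraMap (MvPolynomial (Fin 2) K) _ (MvPolynomial.X 0)) ∧
      ArtinSchreierTower K p w ξ
        (algebraMap (RatFunc₂ K) _ (algebraMap (MvPolynomial (Fin 2) K) _ (MvPolynomial.X 1))) := by
  obtain ⟨Ω, _, _, _, Γ, _, w, x, y, T⟩ :=
    ArtinSchreierTower.exists_of_isAlgClosed (p := p) (RatFunc₂.X_notMem_range (K := K))
  have _ : CharP Ω p := charP_of_injective_algebraMap (algebraMap K Ω).injective p
  let φ : RatFunc₂ K →ₐ[K] Ω := IsFractionRing.liftAlgHom T.injective_aeval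
  have hφ : ∀ f, φ (algebraMap _ _ f) = MvPolynomial.aeval ![x 0, y] f := fun f =>
    IsFractionRing.lift_algebraMap T.injective_aeval f
  let _ : Algebra (RatFunc₂ K) Ω := φ.toRingHom.toAlgebra
  have _ : IsScalarTower K (RatFunc₂ K) Ω := .of_algebraMap_eq fun c => (φ.commutes c).symm
  -- The algebraic closure served above only as a field with an element outside `K`; it is now
  -- embedded afresh, with the two variables going to `x 0` and `y`.
  let ι : AlgebraicClosure (RatFunc₂ K) →ₐ[RatFunc₂ K] Ω := IsAlgClosed.lift
  have hιφ : ∀ z : RatFunc₂ K, ι (algebraMap _ _ z) = φ z := ι.commutes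
  have hx0 : ι (algebraMap (RatFunc₂ K) _ (algebraMap (MvPolynomial (Fin 2) K) _ (MvPolynomial.X 0))) = x 0 := by
    rw [hιφ, hφ, MvPolynomial.aeval_X]; rfl
  have hy : ι (algebraMap (RatFunc₂ K) _ (algebraMap (MvPolynomial (Fin 2) K) _ (MvPolynomial.X 1))) = y := by
    rw [hιφ, hφ, MvPolynomial.aeval_X]; rfl
  -- Two Artin–Schreier roots of the same element differ by an element of the prime field, so the
  -- whole tower lies in the image of `ι`.
  have hξ : ∀ i, ∃ ξ, ι ξ = x i := by
    intro i
    induction i with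
    | zero => exact ⟨_, hx0⟩
    | succ i ih =>
      obtain ⟨ξ, hξ⟩ := ih
      obtain ⟨ρ, rfl⟩ := artinSchreier.surjective_of_isAlgClosed p _ ξ
      have h1 := artinSchreier.map_iterate p ι 1 ρ
      have h2 := artinSchreier.iterate_sub p 1 (x (i + 1)) (ι ρ)
      simp only [Function.iterate_one] at h1 h2
      rw [T.step, ← h1, hξ, sub_self] at h2
      obtain ⟨k, hk⟩ := artinSchreier.eq_zero_iff.1 h2
      exact ⟨ρ + k, by rw [map_add, map_intCast, hk]; ring⟩
  choose ξ hξ using hξ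
  refine ⟨Γ, inferInstance, w.comap ((ι.restrictScalars K : _ →ₐ[K] Ω) : _ →+* Ω), ξ,
    ι.injective ((hξ 0).trans hx0.symm), ArtinSchreierTower.of_comap (ι.restrictScalars K) ?_⟩
  convert T using 1
  · exact funext hξ
  · exact hy

theorem theorem1p2 (K : Type u) [Field K] [IsAlgClosed K] (p : ℕ) [CharP K p] (hp : 0 < p) :
    -- a valuation `v` on `K(x, y)` that is trivial on `K`
    ∃ (Γ : Type u) (_ : LinearOrderedCommGroupWithZero Γ) (v : Valuation (RatFunc₂ K) Γ),
      (∀ c : K, c ≠ 0 → v (algebraMap K (RatFunc₂ K) c) = 1) ∧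
      -- an extension `w` of `v` to an algebraic closure of `K(x, y)`,
      -- with which all fields of the chain are endowed
      ∃ w : Valuation (AlgebraicClosure (RatFunc₂ K)) Γ,
        ValExt.restrict (RatFunc₂ K) w = v ∧
        -- the infinite chain `K(x, y) = L 0 ⊆ L 1 ⊆ L 2 ⊆ …`
        ∃ L : ℕ → IntermediateField (RatFunc₂ K) (AlgebraicClosure (RatFunc₂ K)),
          L 0 = ⊥ ∧
          ∃ hL : ∀ i, L i ≤ L (i + 1),
            ∀ i, ValExt.IsImmediateGaloisOfDegreeDefect (L i)
              (ValExt.restrict (IntermediateField.extendScalars (hL i)) w) p p := by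
  have _ : Fact p.Prime := ⟨(CharP.char_is_prime_or_zero K p).resolve_right hp.ne'⟩
  obtain ⟨Γ, _, w, ξ, h0, T⟩ := ArtinSchreierTower.exists_on_algebraicClosure K p
  refine ⟨Γ, inferInstance, ValExt.restrict (RatFunc₂ K) w, fun c hc => ?_, w, rfl,
    fun i => IntermediateField.adjoin (RatFunc₂ K) {ξ i}, ?_, T.adjoin_le _, fun i => ?_⟩
  · rw [Valuation.comap_apply, ← IsScalarTower.algebraMap_apply]
    exact T.map_const c hc
  · rw [IntermediateField.adjoin_simple_eq_bot_iff, h0]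
    exact IntermediateField.algebraMap_mem _ _
  · exact T.isImmediateGaloisOfDegreeDefect h0.symm rfl RatFunc₂.exists_eq_div i rfl rfl
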